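/- Let $0\le q<k$ and $n$ be natural numbers, let $f_0,\dots,f_k:\mathbb R^n\to\overline{\mathbb R}$ be proper convex functions and let $x^\star\in\mathbb R^n$. Write $\partial f(x^\star)=\{u: f(x^\star+t)\ge f(x^\star)+\langle u,t\rangle\ \forall t\in\mathbb R^n\}$ for the subdifferential, $D(f,x^\star)=\{d:\exists a>0,\ f(x^\star+a d)\le f(x^\star)\}$ for the descent cone, $N(f,x^\star)=\{u:\langle u,d\rangle\le 0\ \forall d\in D(f,x^\star)\}$ for the normal cone, and $$\mathcal C=\{u\in\mathbb R^n:\exists t>0,\ f_i(x^\star+t u)\le f_i(x^\star),\ i=0,\dots,k\}$$ for the prior restricted cone. The statistical dimension of a convex cone $K\subseteq\mathbb R^n$ is $\delta(K)=\mathbb E\big(\sup_{t\in K,\|t\|_2\le 1}\langle g,t\rangle\big)^2$, where $g\sim N(0,I_n)$. Let $\mathbb R^{q+1}_+$ be the (closed) nonnegative orthant and $\mathbb S^q$ the Euclidean unit sphere of $\mathbb R^{q+1}$. Assume that 1. for $0\le i\le q$ the set $\partial f_i(x^\star)$ is non-empty, compact, and does not contain the origin, and for $q<i\le k$ the set $\partial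 f_i(x^\star)$ is non-empty; 2. the relative interiors of the descent cones have a common point: $\bigcap_{i=0}^k \mathrm{ri}\big(D(f_i,x^\star)\big)\ne\emptyset$; 3. for every $\tau\in\mathbb S^q\cap\mathbb R^{q+1}_+$, $\ 0\notin \mathrm{cl}\big(\sum_{i=q+1}^k N(f_i,x^\star)\big)+\sum_{i=0}^q\tau_i\,\partial f_i(x^\star)$. For $\tau\in\mathbb R^{q+1}_+$ define $$J(\tau)=\mathbb E\Big[\mathrm{dist}^2\Big(g,\ \sum_{i=0}^q\tau_i\,\partial f_i(x^\star)+\sum_{i=q+1}^k N(f_i,x^\star)\Big)\Big],\qquad g\sim N(0,I_n).$$ Then the expectations defining $\delta(\mathcal C)$ and $J(\tau)$ are finite, and $$\delta(\mathcal C)\le\inf_{\tau\in\mathbb R^{q+1}_+}J(\tau).$$ The function $J$ is convex, continuous, and continuously differentiable on $\mathbb R^{q+1}_+$, where at boundary points the differential is taken relative to $\mathbb R^{q+1}_+$ and $\partial J/\partial\tau_i$ is the right derivative if $\tau_i=0$. It attains its minimum over $\mathbb R^{q+1}_+$, and all its minimizers lie in a compact subset of $\mathbb R^{q+1}_+$.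 Moreover, if for all $\tau\ne\tilde\tau$ in $\mathbb R^{q+1}_+$ the two sets $$\mathrm{cl}\Big(\sum_{i=q+1}^k N(f_i,x^\star)\Big)+\sum_{i=0}^q\tau_i\,\partial f_i(x^\star)\quad\text{and}\quad \mathrm{cl}\Big(\sum_{i=q+1}^k N(f_i,x^\star)\Big)+\sum_{i=0}^q\tilde\tau_i\,\partial f_i(x^\star)$$ are not identical, then $J$ is strictly convex on $\mathbb R^{q+1}_+$ and attains its minimum at a unique point. -/

import Mathlib

open MeasureTheory ProbabilityTheory
open scoped Pointwise

noncomputable section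

/-- The Euclidean space `ℝⁿ`. -/
abbrev Eucl (n : ℕ) : Type := EuclideanSpace ℝ (Fin n)

/-- A proper convex function `h : ℝⁿ → [-∞, ∞]`: it never takes the value `-∞`, it is not
identically `∞`, and its epigraph is convex. -/
structure IsProperConvex {n : ℕ} (h : Eucl n → EReal) : Prop where
  ne_bot : ∀ x, h x ≠ ⊥
  exists_ne_top : ∃ x, h x ≠ ⊤
  convex_epigraph : Convex ℝ {p : Eucl n × ℝ | h p.1 ≤ (p.2 : EReal)}

/-- The subdifferential of `h` at `z`. -/
def subdifferential {n : ℕ} (h : Eucl n → EReal) (z : Eucl n) : Set (Eucl n) :=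
  {u | ∀ t : Eucl n, h z + ((inner ℝ u t : ℝ) : EReal) ≤ h (z + t)}

/-- The descent cone of `h` at `z`: all non-ascent directions of `h` at `z`. -/
def descentCone {n : ℕ} (h : Eucl n → EReal) (z : Eucl n) : Set (Eucl n) :=
  {d | ∃ a : ℝ, 0 < a ∧ h (z + a • d) ≤ h z}

/-- The polar cone of a set. -/
def polarCone {n : ℕ} (C : Set (Eucl n)) : Set (Eucl n) :=
  {u | ∀ d ∈ C, inner ℝ u d ≤ (0 : ℝ)}

/-- The normal cone of `h` at `z`: the polar of the descent cone. -/
def normalCone {n : ℕ} (h : Eucl n → EReal) (z : Eucl n) : Set (Eucl n) :=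
  polarCone (descentCone h z)

/-- The prior restricted cone of the functions `f₀, …, f_k` at `x`: the cone generated by
`{d | f_i (x + d) ≤ f_i x for all i}`. -/
def priorRestrictedCone {n k : ℕ} (f : Fin (k + 1) → Eucl n → EReal) (x : Eucl n) :
    Set (Eucl n) :=
  {u | ∃ t : ℝ, 0 < t ∧ ∀ i, f i (x + t • u) ≤ f i x}

/-- `(sup_{t ∈ K, ‖t‖ ≤ 1} ⟨g, t⟩)²`. -/
def supSq {n : ℕ} (K : Set (Eucl n)) (g : Eucl n) : ℝ :=
  (⨆ t : ↥(K ∩ Metric.closedBall (0 : Eucl n) 1), (inner ℝ g (t : Eucl n) : ℝ)) ^ 2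

/-- The statistical dimension `E (sup_{t ∈ K, ‖t‖ ≤ 1} ⟨g, t⟩)²`, with `g` standard normal. -/
def statDim {n : ℕ} (K : Set (Eucl n)) : ℝ :=
  ∫ g, supSq K g ∂(stdGaussian (Eucl n))

/-- The nonnegative orthant of `ℝᵐ`. -/
def nonnegOrthant (m : ℕ) : Set (Eucl m) := {τ | ∀ i, 0 ≤ τ i}

/-- The Minkowski sum `∑_{i ≤ q} τ_i ∂f_i(x)`. -/
def subdiffSum {n k q : ℕ} (hq : q < k) (f : Fin (k + 1) → Eucl n → EReal) (x : Eucl n)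
    (τ : Eucl (q + 1)) : Set (Eucl n) :=
  ∑ i : Fin (q + 1), τ i • subdifferential (f (i.castLE (by omega))) x

/-- The Minkowski sum `∑_{q < i ≤ k} N(f_i, x)`. -/
def normalSum {n k : ℕ} (q : ℕ) (f : Fin (k + 1) → Eucl n → EReal) (x : Eucl n) :
    Set (Eucl n) :=
  ∑ i : Fin (k + 1) with q < i.val, normalCone (f i) x

/-- The squared distance from `g` to `∑_{i ≤ q} τ_i ∂f_i(x) + ∑_{q < i ≤ k} N(f_i, x)`. -/
def distSq {n k q : ℕ} (hq : q < k) (f : Fin (k + 1) → Eucl n → EReal) (x : Eucl n)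
    (τ : Eucl (q + 1)) (g : Eucl n) : ℝ :=
  Metric.infDist g (subdiffSum hq f x τ + normalSum q f x) ^ 2

/-- `J(τ) = E dist²(g, ∑_{i ≤ q} τ_i ∂f_i(x) + ∑_{q < i ≤ k} N(f_i, x))`, `g` standard normal. -/
def recipeJ {n k q : ℕ} (hq : q < k) (f : Fin (k + 1) → Eucl n → EReal) (x : Eucl n)
    (τ : Eucl (q + 1)) : ℝ :=
  ∫ g, distSq hq f x τ g ∂(stdGaussian (Eucl n))

end

section SupportFunction

variable {E : Type*} [NormedAddCommGroup E] [InnerProductSpace ℝ E]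

/-- The support function of a set. -/
noncomputable def supportFn (T : Set E) (r : E) : ℝ := ⨆ t : T, (inner ℝ r (t : E) : ℝ)

lemma bddAbove_range_inner {T : Set E} {B : ℝ} (hB : ∀ t ∈ T, ‖t‖ ≤ B) (r : E) :
    BddAbove (Set.range fun t : T => (inner ℝ r (t : E) : ℝ)) := by
  refine ⟨‖r‖ * B, ?_⟩
  rintro _ ⟨t, rfl⟩
  exact (real_inner_le_norm _ _).trans
    (mul_le_mul_of_nonneg_left (hB t t.2) (norm_nonneg _))

lemma inner_le_supportFn {T : Set E} {B : ℝ} (hB : ∀ t ∈ T, ‖t‖ ≤ B) (r : E) {t : E}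
    (ht : t ∈ T) : inner ℝ r t ≤ supportFn T r :=
  le_ciSup (bddAbove_range_inner hB r) (⟨t, ht⟩ : T)

lemma supportFn_le {T : Set E} (hT : T.Nonempty) {r : E} {a : ℝ}
    (h : ∀ t ∈ T, inner ℝ r t ≤ a) : supportFn T r ≤ a :=
  have := hT.to_subtype
  ciSup_le fun t => h t t.2

lemma supportFn_zero (T : Set E) : supportFn T (0 : E) = 0 := by
  simp [supportFn]

lemma supportFn_le_add {T : Set E} (hT : T.Nonempty) {B : ℝ} (hB : ∀ t ∈ T, ‖t‖ ≤ B)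
    (r r' : E) : supportFn T r ≤ supportFn T r' + B * ‖r - r'‖ := by
  refine supportFn_le hT fun t ht => ?_
  have h1 : inner ℝ r t = inner ℝ r' t + (inner ℝ (r - r') t : ℝ) := by
    rw [inner_sub_left]; ring
  have h2 := inner_le_supportFn hB r' ht
  have h3 : inner ℝ (r - r') t ≤ B * ‖r - r'‖ := by
    rw [mul_comm]
    exact (real_inner_le_norm _ _).trans
      (mul_le_mul_of_nonneg_left (hB t ht) (norm_nonneg _))
  linarith

lemma abs_supportFn_sub_le {T : Set E} (hT : T.Nonempty) {B : ℝ} (hB : ∀ t ∈ T, ‖t‖ ≤ B)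
    (r r' : E) : |supportFn T r - supportFn T r'| ≤ B * ‖r - r'‖ := by
  have h1 := supportFn_le_add hT hB r r'
  have h2 := supportFn_le_add hT hB r' r
  rw [norm_sub_rev] at h2
  rw [abs_le]
  constructor <;> linarith

lemma abs_supportFn_le {T : Set E} (hT : T.Nonempty) {B : ℝ} (hB : ∀ t ∈ T, ‖t‖ ≤ B)
    (r : E) : |supportFn T r| ≤ B * ‖r‖ := by
  simpa [supportFn_zero] using abs_supportFn_sub_le hT hB r 0

lemma continuous_supportFn {T : Set E} (hT : T.Nonempty) {B : ℝ} (hB : ∀ t ∈ T, ‖t‖ ≤ B) :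
    Continuous (supportFn T) := by
  have hB0 : 0 ≤ B := (norm_nonneg _).trans (hB _ hT.some_mem)
  refine (LipschitzWith.of_dist_le_mul (K := ⟨B, hB0⟩) fun r r' => ?_).continuous
  rw [Real.dist_eq, dist_eq_norm]
  exact abs_supportFn_sub_le hT hB r r'

end SupportFunction

section Residual

variable {E : Type*} [NormedAddCommGroup E] [InnerProductSpace ℝ E]

/-- The residual `g - p` where `p` is a point of `C` nearest to `g`. -/
noncomputable def distResidual (C : Set E) (g : E) : E :=
  Classical.epsilon fun r : E =>
    g - r ∈ C ∧ Metric.infDist g C = ‖r‖ ∧ ∀ c ∈ C, inner ℝ r (c - (g - r)) ≤ 0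

lemma distResidual_spec [FiniteDimensional ℝ E] {C : Set E} (hne : C.Nonempty) (hcl : IsClosed C)
    (hcv : Convex ℝ C) (g : E) :
    g - distResidual C g ∈ C ∧ Metric.infDist g C = ‖distResidual C g‖ ∧
      ∀ c ∈ C, inner ℝ (distResidual C g) (c - (g - distResidual C g)) ≤ 0 := by
  refine Classical.epsilon_spec (p := fun r : E =>
    g - r ∈ C ∧ Metric.infDist g C = ‖r‖ ∧ ∀ c ∈ C, inner ℝ r (c - (g - r)) ≤ 0) ?_
  obtain ⟨p, hp, hmin⟩ := exists_norm_eq_iInf_of_complete_convex hne hcl.isComplete hcv g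
  refine ⟨g - p, by simpa using hp, ?_, ?_⟩
  · rw [hmin, Metric.infDist_eq_iInf]
    simp only [dist_eq_norm]
  · simpa using (norm_eq_iInf_iff_real_inner_le_zero hcv hp).1 hmin

end Residual

section WeightedSum

variable {ι E : Type*} [Fintype ι] [NormedAddCommGroup E] [InnerProductSpace ℝ E]

/-- The set `K + ∑ i, τ i • S i`. -/
def weightedSum (K : Set E) (S : ι → Set E) (τ : EuclideanSpace ℝ ι) : Set E :=
  K + ∑ i, τ i • S i

/-- A nonempty closed convex cone together with nonempty compact convex sets. -/
structure ConeAndCompacts (K : Set E) (S : ι → Set E) : Prop where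
  isClosed : IsClosed K
  convex_cone : Convex ℝ K
  zero_mem : (0 : E) ∈ K
  smul_mem : ∀ t : ℝ, 0 < t → ∀ c ∈ K, t • c ∈ K
  isCompact : ∀ i, IsCompact (S i)
  convex : ∀ i, Convex ℝ (S i)
  nonempty : ∀ i, (S i).Nonempty

/-- The vectors with nonnegative coordinates. -/
def orthant (ι : Type*) : Set (EuclideanSpace ℝ ι) := {τ | ∀ i, 0 ≤ τ i}

lemma mem_sum_smul {S : ι → Set E} {τ : EuclideanSpace ℝ ι} {c : E} :
    c ∈ ∑ i, τ i • S i ↔ ∃ s : ι → E, (∀ i, s i ∈ S i) ∧ ∑ i, τ i • s i = c := by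
  rw [Set.mem_fintype_sum]
  constructor
  · rintro ⟨v, hv, rfl⟩
    choose s hs hsv using fun i => Set.mem_smul_set.1 (hv i)
    exact ⟨s, hs, by simp [hsv]⟩
  · rintro ⟨s, hs, rfl⟩
    exact ⟨fun i => τ i • s i, fun i => Set.smul_mem_smul_set (hs i), rfl⟩

lemma mem_weightedSum {K : Set E} {S : ι → Set E} {τ : EuclideanSpace ℝ ι} {c : E} :
    c ∈ weightedSum K S τ ↔
      ∃ a ∈ K, ∃ s : ι → E, (∀ i, s i ∈ S i) ∧ a + ∑ i, τ i • s i = c := by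
  rw [weightedSum, Set.mem_add]
  constructor
  · rintro ⟨a, ha, b, hb, rfl⟩
    obtain ⟨s, hs, rfl⟩ := mem_sum_smul.1 hb
    exact ⟨a, ha, s, hs, rfl⟩
  · rintro ⟨a, ha, s, hs, rfl⟩
    exact ⟨a, ha, _, mem_sum_smul.2 ⟨s, hs, rfl⟩, rfl⟩

lemma isCompact_sum_smul {S : ι → Set E} (hS : ∀ i, IsCompact (S i))
    (τ : EuclideanSpace ℝ ι) : IsCompact (∑ i, τ i • S i) := by
  have h : (∑ i, τ i • S i) = (fun s : ι → E => ∑ i, τ i • s i) '' Set.univ.pi S := by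
    ext c
    simp [mem_sum_smul]
  rw [h]
  exact (isCompact_univ_pi hS).image (by fun_prop)

lemma convex_orthant (ι : Type*) : Convex ℝ (orthant ι) := by
  intro τ hτ τ' hτ' a b ha hb _ i
  have := mul_nonneg ha (hτ i)
  have := mul_nonneg hb (hτ' i)
  simp only [PiLp.add_apply, PiLp.smul_apply, smul_eq_mul]
  linarith

lemma isClosed_orthant (ι : Type*) : IsClosed (orthant ι) := by
  simp only [orthant, Set.ofPred_forall]
  exact isClosed_iInter fun i => isClosed_le continuous_const (by fun_prop)

namespace ConeAndCompacts

variable {K : Set E} {S : ι → Set E} (h : ConeAndCompacts K S)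
include h

lemma weightedSum_nonempty (τ : EuclideanSpace ℝ ι) : (weightedSum K S τ).Nonempty := by
  choose s hs using h.nonempty
  exact ⟨_, mem_weightedSum.2 ⟨0, h.zero_mem, s, hs, rfl⟩⟩

lemma isClosed_weightedSum (τ : EuclideanSpace ℝ ι) : IsClosed (weightedSum K S τ) :=
  h.isClosed.add_right_of_isCompact (isCompact_sum_smul h.isCompact τ)

lemma combo_mem_weightedSum {τ τ' : EuclideanSpace ℝ ι} (hτ : τ ∈ orthant ι)
    (hτ' : τ' ∈ orthant ι) {a b : ℝ} (ha : 0 ≤ a) (hb : 0 ≤ b) (hab : a + b = 1) {c c' : E}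
    (hc : c ∈ weightedSum K S τ) (hc' : c' ∈ weightedSum K S τ') :
    a • c + b • c' ∈ weightedSum K S (a • τ + b • τ') := by
  obtain ⟨u, hu, s, hs, rfl⟩ := mem_weightedSum.1 hc
  obtain ⟨u', hu', s', hs', rfl⟩ := mem_weightedSum.1 hc'
  choose w hw hws using fun i => (h.convex i).exists_mem_add_smul_eq (hs i) (hs' i)
    (mul_nonneg ha (hτ i)) (mul_nonneg hb (hτ' i))
  refine mem_weightedSum.2 ⟨a • u + b • u', h.convex_cone hu hu' ha hb hab, w, hw, ?_⟩
  have : ∀ i, (a • τ + b • τ') i • w i = a • τ i • s i + b • τ' i • s' i := by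
    intro i
    simp only [PiLp.add_apply, PiLp.smul_apply, smul_eq_mul]
    rw [hws i, mul_smul, mul_smul]
  simp only [this, Finset.sum_add_distrib, smul_add, Finset.smul_sum]
  abel

lemma convex_weightedSum {τ : EuclideanSpace ℝ ι} (hτ : τ ∈ orthant ι) :
    Convex ℝ (weightedSum K S τ) := by
  intro c hc c' hc' a b ha hb hab
  have := h.combo_mem_weightedSum hτ hτ ha hb hab hc hc'
  rwa [← add_smul, hab, one_smul] at this

lemma smul_mem_weightedSum {τ : EuclideanSpace ℝ ι} {t : ℝ} (ht : 0 < t) {c : E}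
    (hc : c ∈ weightedSum K S τ) : t • c ∈ weightedSum K S (t • τ) := by
  obtain ⟨u, hu, s, hs, rfl⟩ := mem_weightedSum.1 hc
  refine mem_weightedSum.2 ⟨t • u, h.smul_mem t ht u hu, s, hs, ?_⟩
  simp [smul_add, Finset.smul_sum, mul_smul]

lemma exists_norm_le : ∃ B : ℝ, 0 ≤ B ∧ ∀ i, ∀ s ∈ S i, ‖s‖ ≤ B := by
  choose b hb using fun i => (h.isCompact i).isBounded.exists_norm_le
  refine ⟨∑ i, |b i|, Finset.sum_nonneg fun _ _ => abs_nonneg _, fun i s hs => ?_⟩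
  exact ((hb i s hs).trans (le_abs_self _)).trans
    (Finset.single_le_sum (f := fun i => |b i|) (fun _ _ => abs_nonneg _) (Finset.mem_univ i))

lemma infDist_weightedSum_combo_le {τ τ' : EuclideanSpace ℝ ι} (hτ : τ ∈ orthant ι)
    (hτ' : τ' ∈ orthant ι) {a b : ℝ} (ha : 0 ≤ a) (hb : 0 ≤ b) (hab : a + b = 1)
    [FiniteDimensional ℝ E] (g : E) :
    Metric.infDist g (weightedSum K S (a • τ + b • τ')) ≤
      a * Metric.infDist g (weightedSum K S τ) + b * Metric.infDist g (weightedSum K S τ') := by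
  obtain ⟨c, hc, hcd⟩ :=
    (h.isClosed_weightedSum τ).exists_infDist_eq_dist (h.weightedSum_nonempty τ) g
  obtain ⟨c', hc', hcd'⟩ :=
    (h.isClosed_weightedSum τ').exists_infDist_eq_dist (h.weightedSum_nonempty τ') g
  rw [hcd, hcd']
  refine (Metric.infDist_le_dist_of_mem
    (h.combo_mem_weightedSum hτ hτ' ha hb hab hc hc')).trans ?_
  have h1 : g - (a • c + b • c') = a • (g - c) + b • (g - c') := by
    have : g = (a + b) • g := by rw [hab, one_smul]
    nth_rw 1 [this]
    rw [add_smul, smul_sub, smul_sub]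
    abel
  rw [dist_eq_norm, h1, dist_eq_norm, dist_eq_norm]
  refine (norm_add_le _ _).trans ?_
  rw [norm_smul, norm_smul, Real.norm_of_nonneg ha, Real.norm_of_nonneg hb]

variable [FiniteDimensional ℝ E]

lemma residual_mem {τ : EuclideanSpace ℝ ι} (hτ : τ ∈ orthant ι) (g : E) :
    g - distResidual (weightedSum K S τ) g ∈ weightedSum K S τ :=
  (distResidual_spec (h.weightedSum_nonempty τ) (h.isClosed_weightedSum τ)
    (h.convex_weightedSum hτ) g).1

lemma infDist_eq_norm_residual {τ : EuclideanSpace ℝ ι} (hτ : τ ∈ orthant ι) (g : E) :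
    Metric.infDist g (weightedSum K S τ) = ‖distResidual (weightedSum K S τ) g‖ :=
  (distResidual_spec (h.weightedSum_nonempty τ) (h.isClosed_weightedSum τ)
    (h.convex_weightedSum hτ) g).2.1

lemma inner_residual_le {τ : EuclideanSpace ℝ ι} (hτ : τ ∈ orthant ι) (g : E) {c : E}
    (hc : c ∈ weightedSum K S τ) :
    inner ℝ (distResidual (weightedSum K S τ) g) c ≤
      inner ℝ (distResidual (weightedSum K S τ) g) (g - distResidual (weightedSum K S τ) g) := by
  have := (distResidual_spec (h.weightedSum_nonempty τ) (h.isClosed_weightedSum τ)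
    (h.convex_weightedSum hτ) g).2.2 c hc
  rw [inner_sub_right] at this
  linarith

lemma inner_residual_cone_le_zero {τ : EuclideanSpace ℝ ι} (hτ : τ ∈ orthant ι) (g : E) {u : E}
    (hu : u ∈ K) : inner ℝ (distResidual (weightedSum K S τ) g) u ≤ 0 := by
  obtain ⟨a, ha, s, hs, hc⟩ := mem_weightedSum.1 (h.residual_mem hτ g)
  set r := distResidual (weightedSum K S τ) g with hr
  have hmem : (a + u) + ∑ i, τ i • s i ∈ weightedSum K S τ := by
    refine mem_weightedSum.2 ⟨a + u, ?_, s, hs, rfl⟩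
    have := h.smul_mem 2 two_pos _ (h.convex_cone ha hu (by norm_num : (0 : ℝ) ≤ 1 / 2)
      (by norm_num : (0 : ℝ) ≤ 1 / 2) (by norm_num))
    simpa [smul_add, smul_smul] using this
  have h1 := h.inner_residual_le hτ g hmem
  rw [← hr, ← hc, inner_add_right, inner_add_right, inner_add_right] at h1
  linarith

lemma inner_residual_le_sum {τ : EuclideanSpace ℝ ι} (hτ : τ ∈ orthant ι) (g : E)
    {τ' : EuclideanSpace ℝ ι} (hτ' : τ' ∈ orthant ι) {c : E} (hc : c ∈ weightedSum K S τ') :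
    inner ℝ (distResidual (weightedSum K S τ) g) c ≤
      ∑ i, τ' i * supportFn (S i) (distResidual (weightedSum K S τ) g) := by
  obtain ⟨B, -, hB⟩ := h.exists_norm_le
  obtain ⟨a, ha, s, hs, rfl⟩ := mem_weightedSum.1 hc
  have h1 := h.inner_residual_cone_le_zero hτ g ha
  rw [inner_add_right, inner_sum]
  have h2 : ∑ i, inner ℝ (distResidual (weightedSum K S τ) g) (τ' i • s i) ≤
      ∑ i, τ' i * supportFn (S i) (distResidual (weightedSum K S τ) g) := by
    refine Finset.sum_le_sum fun i _ => ?_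
    rw [inner_smul_right]
    exact mul_le_mul_of_nonneg_left (inner_le_supportFn (hB i) _ (hs i)) (hτ' i)
  linarith

lemma inner_residual_eq_sum {τ : EuclideanSpace ℝ ι} (hτ : τ ∈ orthant ι) (g : E) :
    inner ℝ (distResidual (weightedSum K S τ) g) (g - distResidual (weightedSum K S τ) g) =
      ∑ i, τ i * supportFn (S i) (distResidual (weightedSum K S τ) g) := by
  refine le_antisymm (h.inner_residual_le_sum hτ g hτ (h.residual_mem hτ g)) ?_
  set r := distResidual (weightedSum K S τ) g with hr
  have hmax : ∀ i, ∃ s ∈ S i, supportFn (S i) r ≤ inner ℝ r s := by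
    intro i
    obtain ⟨s, hs, hmax⟩ := (h.isCompact i).exists_isMaxOn (h.nonempty i)
      (f := fun s => (inner ℝ r s : ℝ)) (by fun_prop)
    exact ⟨s, hs, supportFn_le (h.nonempty i) fun t ht => hmax ht⟩
  choose s hs hmax using hmax
  have h1 := h.inner_residual_le hτ g (mem_weightedSum.2 ⟨0, h.zero_mem, s, hs, rfl⟩)
  refine le_trans ?_ h1
  rw [zero_add, inner_sum]
  refine Finset.sum_le_sum fun i _ => ?_
  rw [inner_smul_right]
  exact mul_le_mul_of_nonneg_left (hmax i) (hτ i)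

lemma infDist_sq_subgradient {τ τ' : EuclideanSpace ℝ ι} (hτ : τ ∈ orthant ι)
    (hτ' : τ' ∈ orthant ι) (g : E) :
    Metric.infDist g (weightedSum K S τ) ^ 2 +
        ∑ i, (τ' i - τ i) * (-2 * supportFn (S i) (distResidual (weightedSum K S τ) g)) ≤
      Metric.infDist g (weightedSum K S τ') ^ 2 := by
  rw [h.infDist_eq_norm_residual hτ, h.infDist_eq_norm_residual hτ']
  have h1 := h.inner_residual_eq_sum hτ g
  have h2 := h.inner_residual_le_sum hτ g hτ' (h.residual_mem hτ' g)
  set r := distResidual (weightedSum K S τ) g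
  set r' := distResidual (weightedSum K S τ') g
  have h3 : ∑ i, (τ' i - τ i) * (-2 * supportFn (S i) r) =
      -2 * ∑ i, τ' i * supportFn (S i) r + 2 * ∑ i, τ i * supportFn (S i) r := by
    rw [Finset.mul_sum, Finset.mul_sum, ← Finset.sum_add_distrib]
    exact Finset.sum_congr rfl fun i _ => by ring
  have h4 := norm_sub_sq_real r r'
  have h5 := sq_nonneg ‖r - r'‖
  rw [inner_sub_right] at h1 h2
  rw [real_inner_self_eq_norm_sq] at h1
  rw [h3]
  linarith

lemma norm_residual_sub_le {B : ℝ} (hB : ∀ i, ∀ s ∈ S i, ‖s‖ ≤ B)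
    {τ τ' : EuclideanSpace ℝ ι} (hτ : τ ∈ orthant ι) (hτ' : τ' ∈ orthant ι) (g g' : E) :
    ‖distResidual (weightedSum K S τ) g - distResidual (weightedSum K S τ') g'‖ ≤
      ‖g - g'‖ + B * ∑ i, |τ i - τ' i| := by
  have h1 := h.inner_residual_eq_sum hτ g
  have h2 := h.inner_residual_le_sum hτ g hτ' (h.residual_mem hτ' g')
  have h3 := h.inner_residual_eq_sum hτ' g'
  have h4 := h.inner_residual_le_sum hτ' g' hτ (h.residual_mem hτ g)
  set r := distResidual (weightedSum K S τ) g
  set r' := distResidual (weightedSum K S τ') g'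
  have h5 : ‖r - r'‖ * ‖r - r'‖ = inner ℝ (r - r') (g - g') +
      (inner ℝ r (g' - r') - inner ℝ r (g - r) - inner ℝ r' (g' - r') + inner ℝ r' (g - r)) := by
    rw [← real_inner_self_eq_norm_mul_norm]
    simp only [inner_sub_left, inner_sub_right]
    ring
  have h6 : inner ℝ (r - r') (g - g') ≤ ‖r - r'‖ * ‖g - g'‖ := real_inner_le_norm _ _
  have h7 : ∑ i, τ' i * supportFn (S i) r - ∑ i, τ i * supportFn (S i) r
      - ∑ i, τ' i * supportFn (S i) r' + ∑ i, τ i * supportFn (S i) r' ≤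
      ‖r - r'‖ * (B * ∑ i, |τ i - τ' i|) := by
    rw [← Finset.sum_sub_distrib, ← Finset.sum_sub_distrib, ← Finset.sum_add_distrib,
      Finset.mul_sum, Finset.mul_sum]
    refine Finset.sum_le_sum fun i _ => ?_
    calc τ' i * supportFn (S i) r - τ i * supportFn (S i) r - τ' i * supportFn (S i) r'
          + τ i * supportFn (S i) r'
        = -((τ i - τ' i) * (supportFn (S i) r - supportFn (S i) r')) := by ring
      _ ≤ |(τ i - τ' i) * (supportFn (S i) r - supportFn (S i) r')| := neg_le_abs _
      _ = |τ i - τ' i| * |supportFn (S i) r - supportFn (S i) r'| := abs_mul _ _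
      _ ≤ |τ i - τ' i| * (B * ‖r - r'‖) := mul_le_mul_of_nonneg_left
          (abs_supportFn_sub_le (h.nonempty i) (hB i) _ _) (abs_nonneg _)
      _ = ‖r - r'‖ * (B * |τ i - τ' i|) := by ring
  rcases (norm_nonneg (r - r')).eq_or_lt with h0 | h0
  · rw [← h0]
    rcases isEmpty_or_nonempty ι with hι | ⟨⟨i⟩⟩
    · simp
    · have : 0 ≤ B := (norm_nonneg _).trans (hB i _ (h.nonempty i).some_mem)
      positivity
  · refine le_of_mul_le_mul_left ?_ h0
    rw [mul_add]
    linarith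

lemma continuous_residual {τ : EuclideanSpace ℝ ι} (hτ : τ ∈ orthant ι) :
    Continuous (distResidual (weightedSum K S τ)) := by
  obtain ⟨B, -, hB⟩ := h.exists_norm_le
  refine (LipschitzWith.of_dist_le_mul (K := 1) fun g g' => ?_).continuous
  simpa [dist_eq_norm] using h.norm_residual_sub_le hB hτ hτ g g'

lemma continuousOn_infDist_weightedSum (g : E) :
    ContinuousOn (fun τ => Metric.infDist g (weightedSum K S τ)) (orthant ι) := by
  obtain ⟨B, -, hB⟩ := h.exists_norm_le
  intro τ hτ
  have h0 : Filter.Tendsto (fun τ' : EuclideanSpace ℝ ι => B * ∑ i, |τ' i - τ i|)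
      (nhdsWithin τ (orthant ι)) (nhds 0) := by
    have hc : Continuous fun τ' : EuclideanSpace ℝ ι => B * ∑ i, |τ' i - τ i| := by fun_prop
    have := hc.tendsto τ
    simp only [sub_self, abs_zero, Finset.sum_const_zero, mul_zero] at this
    exact this.mono_left nhdsWithin_le_nhds
  refine tendsto_iff_dist_tendsto_zero.2 (squeeze_zero' (Filter.Eventually.of_forall
    fun _ => dist_nonneg) ?_ h0)
  filter_upwards [self_mem_nhdsWithin] with τ' hτ'
  rw [Real.dist_eq, h.infDist_eq_norm_residual hτ, h.infDist_eq_norm_residual hτ']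
  refine (abs_norm_sub_norm_le _ _).trans ?_
  simpa using h.norm_residual_sub_le hB hτ' hτ g g

lemma exists_pos_mul_norm_le
    (h0 : ∀ τ ∈ Metric.sphere (0 : EuclideanSpace ℝ ι) 1 ∩ orthant ι,
      (0 : E) ∉ weightedSum K S τ) :
    ∃ b : ℝ, 0 < b ∧ ∀ τ ∈ orthant ι, ∀ c ∈ weightedSum K S τ, b * ‖τ‖ ≤ ‖c‖ := by
  have hcomp : IsCompact (Metric.sphere (0 : EuclideanSpace ℝ ι) 1 ∩ orthant ι) :=
    (isCompact_sphere _ _).inter_right (isClosed_orthant ι)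
  obtain ⟨b, hb, hmin⟩ := hcomp.exists_forall_le'
    ((h.continuousOn_infDist_weightedSum 0).mono Set.inter_subset_right) (a := 0)
    (fun τ hτ => ((h.isClosed_weightedSum τ).notMem_iff_infDist_pos
      (h.weightedSum_nonempty τ)).1 (h0 τ hτ))
  refine ⟨b, hb, fun τ hτ c hc => ?_⟩
  rcases (norm_nonneg τ).eq_or_lt with hn | hn
  · rw [← hn, mul_zero]
    exact norm_nonneg c
  · have h1 : ‖τ‖⁻¹ • τ ∈ Metric.sphere (0 : EuclideanSpace ℝ ι) 1 ∩ orthant ι := by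
      refine ⟨by simp [norm_smul, hn.ne'], fun i => ?_⟩
      simpa using mul_nonneg (inv_nonneg.2 hn.le) (hτ i)
    have h2 := (hmin _ h1).trans
      (Metric.infDist_le_dist_of_mem (h.smul_mem_weightedSum (inv_pos.2 hn) hc))
    rw [dist_zero_left, norm_smul, norm_inv, norm_norm, inv_mul_eq_div, le_div_iff₀ hn] at h2
    exact h2

end ConeAndCompacts

end WeightedSum

section Subgradient

variable {F : Type*} [NormedAddCommGroup F] [InnerProductSpace ℝ F]
  {f : F → ℝ} {G : F → F} {s : Set F}

lemma convexOn_of_subgradient (hs : Convex ℝ s)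
    (hsub : ∀ x ∈ s, ∀ y ∈ s, f x + inner ℝ (G x) (y - x) ≤ f y) : ConvexOn ℝ s f := by
  refine ⟨hs, fun x hx y hy a b ha hb hab => ?_⟩
  set z := a • x + b • y with hz
  have hzs : z ∈ s := hs hx hy ha hb hab
  have h1 := mul_le_mul_of_nonneg_left (hsub z hzs x hx) ha
  have h2 := mul_le_mul_of_nonneg_left (hsub z hzs y hy) hb
  have h3 : a * inner ℝ (G z) (x - z) + b * inner ℝ (G z) (y - z) = 0 := by
    rw [← inner_smul_right, ← inner_smul_right, ← inner_add_right]
    have : a • (x - z) + b • (y - z) = 0 := by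
      have : a • (x - z) + b • (y - z) = (a • x + b • y) - (a + b) • z := by module
      rw [this, hab, one_smul, hz, sub_self]
    rw [this, inner_zero_right]
  have h4 : f z = a * f z + b * f z := by rw [← add_mul, hab, one_mul]
  rw [smul_eq_mul, smul_eq_mul, h4]
  linarith

lemma hasGradientWithinAt_of_subgradient [CompleteSpace F] (hG : ContinuousOn G s)
    (hsub : ∀ x ∈ s, ∀ y ∈ s, f x + inner ℝ (G x) (y - x) ≤ f y) {x : F} (hx : x ∈ s) :
    HasGradientWithinAt f (G x) s x := by
  rw [hasGradientWithinAt_iff_isLittleO, Asymptotics.isLittleO_iff]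
  intro c hc
  filter_upwards [self_mem_nhdsWithin, (Metric.tendsto_nhds.1 (hG x hx)) c hc] with y hy hyc
  have h1 := hsub x hx y hy
  have h2 := hsub y hy x hx
  have h3 : inner ℝ (G y - G x) (y - x) ≤ c * ‖y - x‖ :=
    (real_inner_le_norm _ _).trans
      (mul_le_mul_of_nonneg_right (by rw [← dist_eq_norm]; exact hyc.le) (norm_nonneg _))
  rw [inner_sub_left] at h3
  have h4 : inner ℝ (G y) (x - y) = -(inner ℝ (G y) (y - x) : ℝ) := by
    rw [← inner_neg_right, neg_sub]
  rw [Real.norm_eq_abs, abs_le]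
  have := mul_nonneg hc.le (norm_nonneg (y - x))
  constructor <;> linarith

lemma contDiffOn_one_of_hasGradientWithinAt [CompleteSpace F] (hG : ContinuousOn G s)
    (hf : ∀ x ∈ s, HasGradientWithinAt f (G x) s x) : ContDiffOn ℝ 1 f s := by
  rw [show (1 : WithTop ℕ∞) = 0 + 1 from (zero_add 1).symm,
    contDiffOn_succ_iff_hasFDerivWithinAt (by simp)]
  intro x hx
  refine ⟨s, by rw [Set.insert_eq_of_mem hx]; exact self_mem_nhdsWithin, by simp,
    fun y => InnerProductSpace.toDual ℝ F (G y), fun y hy => (hf y hy).hasFDerivWithinAt, ?_⟩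
  exact contDiffOn_zero.2 ((InnerProductSpace.toDual ℝ F).continuous.comp_continuousOn hG)

end Subgradient

section Partial

variable {ι : Type*} [Fintype ι] [DecidableEq ι]

lemma HasGradientWithinAt.hasDerivWithinAt_single {f : EuclideanSpace ℝ ι → ℝ}
    {v τ : EuclideanSpace ℝ ι} (hf : HasGradientWithinAt f v (orthant ι) τ)
    (hτ : τ ∈ orthant ι) (i : ι) :
    HasDerivWithinAt (fun s : ℝ => f (τ + s • EuclideanSpace.single i (1 : ℝ))) (v i)
      (Set.Ici (-(τ i))) 0 := by
  have hline : HasDerivWithinAt (fun s : ℝ => τ + s • EuclideanSpace.single i (1 : ℝ))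
      (EuclideanSpace.single i (1 : ℝ)) (Set.Ici (-(τ i))) 0 := by
    have := ((hasDerivAt_id (0 : ℝ)).smul_const
      (EuclideanSpace.single i (1 : ℝ))).const_add τ
    simpa using this.hasDerivWithinAt
  have hmaps : Set.MapsTo (fun s : ℝ => τ + s • EuclideanSpace.single i (1 : ℝ))
      (Set.Ici (-(τ i))) (orthant ι) := by
    intro s hs j
    rcases eq_or_ne j i with rfl | hj
    · have : -(τ j) ≤ s := hs
      simp only [PiLp.add_apply, PiLp.smul_apply, PiLp.single_apply, if_true,
        smul_eq_mul, mul_one]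
      linarith
    · simpa [hj] using hτ j
  have hF : HasFDerivWithinAt f (InnerProductSpace.toDual ℝ _ v) (orthant ι)
      (τ + (0 : ℝ) • EuclideanSpace.single i (1 : ℝ)) := by
    simpa using hf.hasFDerivWithinAt
  have := hF.comp_hasDerivWithinAt (0 : ℝ) hline hmaps
  simpa [Function.comp_def, EuclideanSpace.inner_single_right] using this

end Partial

section Mean

lemma integrable_of_le_sq_norm {E : Type*} [NormedAddCommGroup E] [MeasurableSpace E]
    [OpensMeasurableSpace E] [SecondCountableTopology E] {μ : Measure E} [IsFiniteMeasure μ]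
    (hμ : MemLp id 2 μ) {f : E → ℝ}
    (hf : Continuous f) {a : ℝ} (hle : ∀ g, |f g| ≤ (a + ‖g‖) ^ 2) : Integrable f μ := by
  have h1 : Integrable (fun g : E => 2 * a ^ 2 + 2 * ‖g‖ ^ 2) μ :=
    (integrable_const _).add (((memLp_two_iff_integrable_sq_norm hμ.1).1 hμ).const_mul 2)
  refine h1.mono' hf.aestronglyMeasurable (Filter.Eventually.of_forall fun g => ?_)
  rw [Real.norm_eq_abs]
  nlinarith [hle g, sq_nonneg (a - ‖g‖)]

lemma integrable_infDist_sq {E : Type*} [NormedAddCommGroup E] [MeasurableSpace E]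
    [OpensMeasurableSpace E] [SecondCountableTopology E] {μ : Measure E} [IsFiniteMeasure μ]
    (hμ : MemLp id 2 μ) (C : Set E) : Integrable (fun g => Metric.infDist g C ^ 2) μ := by
  refine integrable_of_le_sq_norm hμ ((Metric.continuous_infDist_pt _).pow 2)
    (a := Metric.infDist 0 C) fun g => ?_
  rw [abs_of_nonneg (sq_nonneg _)]
  have := Metric.infDist_le_infDist_add_dist (s := C) (x := g) (y := 0)
  rw [dist_zero_right] at this
  exact pow_le_pow_left₀ Metric.infDist_nonneg this 2

variable {ι E : Type*} [Fintype ι] [NormedAddCommGroup E] [InnerProductSpace ℝ E]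
  [FiniteDimensional ℝ E] [MeasurableSpace E] [BorelSpace E] {μ : Measure E}

/-- The mean squared distance to `K + ∑ i, τ i • S i`. -/
noncomputable def meanDistSq (μ : Measure E) (K : Set E) (S : ι → Set E)
    (τ : EuclideanSpace ℝ ι) : ℝ :=
  ∫ g, Metric.infDist g (weightedSum K S τ) ^ 2 ∂μ

/-- The gradient of `meanDistSq`. -/
noncomputable def meanGrad (μ : Measure E) (K : Set E) (S : ι → Set E)
    (τ : EuclideanSpace ℝ ι) : EuclideanSpace ℝ ι :=
  WithLp.toLp 2 fun i => ∫ g, -2 * supportFn (S i) (distResidual (weightedSum K S τ) g) ∂μ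

namespace ConeAndCompacts

variable {K : Set E} {S : ι → Set E} (h : ConeAndCompacts K S)
include h

lemma integrable_supportFn_residual [IsFiniteMeasure μ] (hμ : MemLp id 2 μ)
    {τ : EuclideanSpace ℝ ι} (hτ : τ ∈ orthant ι) (i : ι) :
    Integrable (fun g => -2 * supportFn (S i) (distResidual (weightedSum K S τ) g)) μ := by
  obtain ⟨B, hB0, hB⟩ := h.exists_norm_le
  have hn : Integrable (fun g : E => ‖g‖) μ := (hμ.integrable one_le_two).norm
  refine Integrable.const_mul ?_ (-2)
  refine Integrable.mono'
    (((integrable_const ‖distResidual (weightedSum K S τ) 0‖).add hn).const_mul B)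
    ((continuous_supportFn (h.nonempty i) (hB i)).comp
      (h.continuous_residual hτ)).aestronglyMeasurable (Filter.Eventually.of_forall fun g => ?_)
  refine (abs_supportFn_le (h.nonempty i) (hB i) _).trans (mul_le_mul_of_nonneg_left ?_ hB0)
  have h1 := h.norm_residual_sub_le hB hτ hτ g 0
  simp only [sub_zero, sub_self, abs_zero, Finset.sum_const_zero, mul_zero, add_zero] at h1
  have h2 := norm_le_norm_add_norm_sub' (distResidual (weightedSum K S τ) g)
    (distResidual (weightedSum K S τ) 0)
  simp only [Pi.add_apply]
  linarith

lemma meanDistSq_subgradient [IsFiniteMeasure μ] (hμ : MemLp id 2 μ)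
    {τ : EuclideanSpace ℝ ι} (hτ : τ ∈ orthant ι) {τ' : EuclideanSpace ℝ ι}
    (hτ' : τ' ∈ orthant ι) :
    meanDistSq μ K S τ + inner ℝ (meanGrad μ K S τ) (τ' - τ) ≤ meanDistSq μ K S τ' := by
  have hint : ∀ i ∈ Finset.univ, Integrable (fun g => (τ' i - τ i) *
      (-2 * supportFn (S i) (distResidual (weightedSum K S τ) g))) μ :=
    fun i _ => (h.integrable_supportFn_residual hμ hτ i).const_mul _
  have h1 : (inner ℝ (meanGrad μ K S τ) (τ' - τ) : ℝ) = ∫ g, ∑ i, (τ' i - τ i) *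
      (-2 * supportFn (S i) (distResidual (weightedSum K S τ) g)) ∂μ := by
    rw [integral_finsetSum _ hint, PiLp.inner_apply]
    refine Finset.sum_congr rfl fun i _ => ?_
    rw [integral_const_mul]
    simp [meanGrad]
  rw [h1, meanDistSq, meanDistSq, ← integral_add (integrable_infDist_sq hμ _)
    (integrable_finsetSum _ hint)]
  exact integral_mono ((integrable_infDist_sq hμ _).add (integrable_finsetSum _ hint))
    (integrable_infDist_sq hμ _) fun g => h.infDist_sq_subgradient hτ hτ' g

lemma continuousOn_meanGrad [IsProbabilityMeasure μ] (hμ : MemLp id 2 μ) :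
    ContinuousOn (meanGrad μ K S) (orthant ι) := by
  obtain ⟨B, hB0, hB⟩ := h.exists_norm_le
  refine (PiLp.continuous_toLp 2 _).comp_continuousOn (continuousOn_pi.2 fun i => ?_)
  intro τ hτ
  have h0 : Filter.Tendsto (fun τ' : EuclideanSpace ℝ ι => 2 * (B * (B * ∑ i, |τ' i - τ i|)))
      (nhdsWithin τ (orthant ι)) (nhds 0) := by
    have hc : Continuous fun τ' : EuclideanSpace ℝ ι =>
      2 * (B * (B * ∑ i, |τ' i - τ i|)) := by fun_prop
    have := hc.tendsto τ
    simp only [sub_self, abs_zero, Finset.sum_const_zero, mul_zero] at this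
    exact this.mono_left nhdsWithin_le_nhds
  refine tendsto_iff_dist_tendsto_zero.2 (squeeze_zero' (Filter.Eventually.of_forall
    fun _ => dist_nonneg) ?_ h0)
  filter_upwards [self_mem_nhdsWithin] with τ' hτ'
  rw [Real.dist_eq, ← integral_sub (h.integrable_supportFn_residual hμ hτ' i)
    (h.integrable_supportFn_residual hμ hτ i), ← Real.norm_eq_abs]
  refine (norm_integral_le_of_norm_le_const (C := 2 * (B * (B * ∑ i, |τ' i - τ i|)))
    (Filter.Eventually.of_forall fun g => ?_)).trans (by simp)
  rw [← mul_sub, norm_mul, Real.norm_eq_abs (_ - _)]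
  have h1 := abs_supportFn_sub_le (h.nonempty i) (hB i)
    (distResidual (weightedSum K S τ') g) (distResidual (weightedSum K S τ) g)
  have h2 := h.norm_residual_sub_le hB hτ' hτ g g
  rw [sub_self, norm_zero, zero_add] at h2
  have h3 := h1.trans (mul_le_mul_of_nonneg_left h2 hB0)
  simp only [norm_neg, Real.norm_ofNat]
  linarith

lemma sq_norm_le_meanDistSq [IsProbabilityMeasure μ] (hμ : MemLp id 2 μ) {b : ℝ} (hb : 0 < b)
    (hle : ∀ τ ∈ orthant ι, ∀ c ∈ weightedSum K S τ, b * ‖τ‖ ≤ ‖c‖)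
    {τ : EuclideanSpace ℝ ι} (hτ : τ ∈ orthant ι) :
    (b * ‖τ‖) ^ 2 ≤ 2 * meanDistSq μ K S τ + 2 * ∫ g, ‖g‖ ^ 2 ∂μ := by
  have hn : Integrable (fun g : E => ‖g‖ ^ 2) μ :=
    (memLp_two_iff_integrable_sq_norm hμ.1).1 hμ
  rw [meanDistSq, ← integral_const_mul, ← integral_const_mul,
    ← integral_add ((integrable_infDist_sq hμ _).const_mul 2) (hn.const_mul 2)]
  have h1 : (b * ‖τ‖) ^ 2 = ∫ _ : E, (b * ‖τ‖) ^ 2 ∂μ := by simp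
  rw [h1]
  refine integral_mono (integrable_const _)
    (((integrable_infDist_sq hμ _).const_mul 2).add (hn.const_mul 2)) fun g => ?_
  obtain ⟨c, hc, hcd⟩ :=
    (h.isClosed_weightedSum τ).exists_infDist_eq_dist (h.weightedSum_nonempty τ) g
  have h2 := hle τ hτ c hc
  have h3 : ‖c‖ ≤ ‖g‖ + ‖g - c‖ := norm_le_norm_add_norm_sub _ _
  have h4 : 0 ≤ b * ‖τ‖ := by positivity
  simp only [hcd, dist_eq_norm]
  nlinarith [sq_nonneg (‖g‖ - ‖g - c‖), pow_le_pow_left₀ h4 (h2.trans h3) 2]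

lemma exists_isCompact_minimizers [IsProbabilityMeasure μ] (hμ : MemLp id 2 μ)
    (hcont : ContinuousOn (meanDistSq μ K S) (orthant ι))
    (h0 : ∀ τ ∈ Metric.sphere (0 : EuclideanSpace ℝ ι) 1 ∩ orthant ι,
      (0 : E) ∉ weightedSum K S τ) :
    ∃ C ⊆ orthant ι, IsCompact C ∧ (∃ τ ∈ C, IsMinOn (meanDistSq μ K S) (orthant ι) τ) ∧
      ∀ τ ∈ orthant ι, IsMinOn (meanDistSq μ K S) (orthant ι) τ → τ ∈ C := by
  obtain ⟨b, hb, hle⟩ := h.exists_pos_mul_norm_le h0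
  have hz : (0 : EuclideanSpace ℝ ι) ∈ orthant ι := fun i => le_rfl
  set C := orthant ι ∩ (meanDistSq μ K S) ⁻¹' Set.Iic (meanDistSq μ K S 0) with hC
  have hclosed : IsClosed C := hcont.preimage_isClosed_of_isClosed (isClosed_orthant ι) isClosed_Iic
  have hbdd : Bornology.IsBounded C := by
    refine isBounded_iff_forall_norm_le.2
      ⟨(2 * meanDistSq μ K S 0 + 2 * ∫ g, ‖g‖ ^ 2 ∂μ + 1) / b, fun τ hτ => ?_⟩
    rw [le_div_iff₀ hb]
    have h1 := h.sq_norm_le_meanDistSq hμ hb hle hτ.1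
    have h2 : meanDistSq μ K S τ ≤ meanDistSq μ K S 0 := hτ.2
    nlinarith [sq_nonneg (b * ‖τ‖ - 1), norm_nonneg τ]
  have hcomp : IsCompact C := Metric.isCompact_of_isClosed_isBounded hclosed hbdd
  have hzC : (0 : EuclideanSpace ℝ ι) ∈ C := ⟨hz, le_refl (meanDistSq μ K S 0)⟩
  refine ⟨C, Set.inter_subset_left, hcomp, ?_, fun τ hτ hmin => ⟨hτ, hmin hz⟩⟩
  obtain ⟨τ, hτ, hmin⟩ := hcomp.exists_isMinOn ⟨0, hzC⟩ (hcont.mono Set.inter_subset_left)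
  refine ⟨τ, hτ, fun τ' hτ' => ?_⟩
  by_cases hc : τ' ∈ C
  · exact hmin hc
  · have h1 : meanDistSq μ K S τ ≤ meanDistSq μ K S 0 := hτ.2
    have h2 : meanDistSq μ K S 0 < meanDistSq μ K S τ' := by
      by_contra hcon
      exact hc ⟨hτ', not_lt.1 hcon⟩
    exact h1.trans h2.le

lemma strictConvexOn_meanDistSq [IsFiniteMeasure μ] [μ.IsOpenPosMeasure] (hμ : MemLp id 2 μ)
    (hinj : ∀ τ ∈ orthant ι, ∀ τ' ∈ orthant ι, τ ≠ τ' →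
      weightedSum K S τ ≠ weightedSum K S τ') :
    StrictConvexOn ℝ (orthant ι) (meanDistSq μ K S) := by
  refine ⟨convex_orthant ι, fun τ hτ τ' hτ' hne a b ha hb hab => ?_⟩
  set d := fun (τ : EuclideanSpace ℝ ι) (g : E) => Metric.infDist g (weightedSum K S τ) with hd
  set D : E → ℝ := fun g => a * d τ g ^ 2 + b * d τ' g ^ 2 - d (a • τ + b • τ') g ^ 2 with hD
  have hint : ∀ τ, Integrable (fun g => d τ g ^ 2) μ := fun τ => integrable_infDist_sq hμ _
  have hcd : ∀ τ, Continuous (d τ) := fun τ => Metric.continuous_infDist_pt _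
  have hcD : Continuous D := by
    have h1 := hcd τ
    have h2 := hcd τ'
    have h3 := hcd (a • τ + b • τ')
    fun_prop
  have hlow : ∀ g, a * b * (d τ g - d τ' g) ^ 2 ≤ D g := by
    intro g
    have h1 := h.infDist_weightedSum_combo_le hτ hτ' ha.le hb.le hab g
    have h2 := pow_le_pow_left₀ Metric.infDist_nonneg h1 2
    have h3 : a * b * (d τ g - d τ' g) ^ 2 =
        a * d τ g ^ 2 + b * d τ' g ^ 2 - (a * d τ g + b * d τ' g) ^ 2 := by
      obtain rfl : b = 1 - a := by linarith
      ring
    rw [h3]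
    exact sub_le_sub_left h2 _
  have hnonneg : 0 ≤ D := fun g => le_trans (by positivity) (hlow g)
  have hintD : Integrable D μ :=
    (((hint τ).const_mul a).add ((hint τ').const_mul b)).sub (hint _)
  obtain ⟨g, hg⟩ : ∃ g, d τ g ≠ d τ' g := by
    by_contra! hcon
    refine hinj τ hτ τ' hτ' hne (Set.ext fun g => ?_)
    rw [(h.isClosed_weightedSum τ).mem_iff_infDist_zero (h.weightedSum_nonempty τ),
      (h.isClosed_weightedSum τ').mem_iff_infDist_zero (h.weightedSum_nonempty τ')]
    rw [show Metric.infDist g (weightedSum K S τ) = _ from hcon g]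
  have hDg : D g ≠ 0 := by
    have : 0 < (d τ g - d τ' g) ^ 2 := by
      have := sub_ne_zero.2 hg
      positivity
    have := hlow g
    have : 0 < a * b * (d τ g - d τ' g) ^ 2 := by positivity
    linarith
  have hpos : 0 < ∫ g, D g ∂μ :=
    integral_pos_of_integrable_nonneg_nonzero hcD hintD hnonneg hDg
  have heq : ∫ g, D g ∂μ = a * meanDistSq μ K S τ + b * meanDistSq μ K S τ' -
      meanDistSq μ K S (a • τ + b • τ') := by
    have h1 := integral_sub (((hint τ).const_mul a).add ((hint τ').const_mul b))
      (hint (a • τ + b • τ'))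
    rw [integral_add' ((hint τ).const_mul a) ((hint τ').const_mul b), integral_const_mul,
      integral_const_mul] at h1
    exact h1
  rw [smul_eq_mul, smul_eq_mul]
  linarith

end ConeAndCompacts

end Mean

lemma isOpenPosMeasure_stdGaussian {E : Type*} [NormedAddCommGroup E] [InnerProductSpace ℝ E]
    [FiniteDimensional ℝ E] [MeasurableSpace E] [BorelSpace E] :
    (stdGaussian E).IsOpenPosMeasure := by
  have : (gaussianReal 0 1).IsOpenPosMeasure :=
    (gaussianReal_absolutelyContinuous' 0 one_ne_zero).isOpenPosMeasure
  refine Continuous.isOpenPosMeasure_map (by fun_prop) fun y => ?_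
  exact ⟨fun i => (stdOrthonormalBasis ℝ E).repr y i, (stdOrthonormalBasis ℝ E).sum_repr y⟩

lemma infDist_add_closure {E : Type*} [NormedAddCommGroup E] {A B : Set E} (hA : A.Nonempty)
    (hB : B.Nonempty) (g : E) : Metric.infDist g (closure A + B) = Metric.infDist g (A + B) := by
  refine le_antisymm (Metric.infDist_le_infDist_of_subset
    (Set.add_subset_add_right subset_closure) (hA.add hB)) ?_
  rw [← Metric.infDist_closure (s := A + B)]
  refine Metric.infDist_le_infDist_of_subset ?_ (hA.closure.add hB)
  rintro _ ⟨a, ha, b, hb, rfl⟩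
  exact map_mem_closure (f := fun v => v + b) (by fun_prop) ha fun v hv => Set.add_mem_add hv hb

variable {n : ℕ}

lemma exists_real_eq_of_subdifferential_nonempty {h : Eucl n → EReal} (hh : IsProperConvex h)
    {z : Eucl n} (hne : (subdifferential h z).Nonempty) : ∃ a : ℝ, h z = a := by
  obtain ⟨u, hu⟩ := hne
  have htop : h z ≠ ⊤ := by
    intro hz
    obtain ⟨y, hy⟩ := hh.exists_ne_top
    have h1 := hu (y - z)
    rw [hz, EReal.top_add_coe, add_sub_cancel] at h1
    exact hy (top_le_iff.1 h1)
  exact ⟨(h z).toReal, (EReal.coe_toReal htop (hh.ne_bot z)).symm⟩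

lemma convex_subdifferential {h : Eucl n → EReal} (hh : IsProperConvex h)
    {z : Eucl n} : Convex ℝ (subdifferential h z) := by
  intro u hu v hv a b ha hb hab t
  obtain ⟨c, hc⟩ := exists_real_eq_of_subdifferential_nonempty hh ⟨u, hu⟩
  have h1 := hu t
  have h2 := hv t
  rw [hc, ← EReal.coe_add] at h1 h2 ⊢
  refine le_trans (EReal.coe_le_coe_iff.2 (?_ : _ ≤ max (c + inner ℝ u t) (c + inner ℝ v t))) ?_
  · rw [inner_add_left, real_inner_smul_left, real_inner_smul_left]
    have h3 := mul_le_mul_of_nonneg_left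
      (le_max_left (c + inner ℝ u t) (c + inner ℝ v t)) ha
    have h4 := mul_le_mul_of_nonneg_left
      (le_max_right (c + inner ℝ u t) (c + inner ℝ v t)) hb
    obtain rfl : b = 1 - a := by linarith
    linarith
  · rcases max_choice (c + inner ℝ u t) (c + inner ℝ v t) with hm | hm <;> rw [hm] <;> assumption

lemma inner_subgradient_nonpos {h : Eucl n → EReal} (hh : IsProperConvex h) {z s d : Eucl n}
    (hs : s ∈ subdifferential h z) (hd : d ∈ descentCone h z) : inner ℝ s d ≤ (0 : ℝ) := by
  obtain ⟨a, ha, had⟩ := hd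
  obtain ⟨c, hc⟩ := exists_real_eq_of_subdifferential_nonempty hh ⟨s, hs⟩
  have h1 := (hs (a • d)).trans had
  rw [hc, ← EReal.coe_add, EReal.coe_le_coe_iff, inner_smul_right] at h1
  by_contra! hcon
  have := mul_pos ha hcon
  linarith

lemma convex_polarCone (C : Set (Eucl n)) : Convex ℝ (polarCone C) := by
  intro u hu v hv a b ha hb _ d hd
  have h1 := mul_nonpos_of_nonneg_of_nonpos ha (hu d hd)
  have h2 := mul_nonpos_of_nonneg_of_nonpos hb (hv d hd)
  rw [inner_add_left, real_inner_smul_left, real_inner_smul_left]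
  linarith

variable {k : ℕ} (q : ℕ) (f : Fin (k + 1) → Eucl n → EReal) (x : Eucl n)

lemma zero_mem_normalSum : (0 : Eucl n) ∈ normalSum q f x :=
  Set.mem_finsetSum _ _ _ |>.2 ⟨fun _ => 0, fun {_} _ => by simp [normalCone, polarCone], by simp⟩

lemma convex_normalSum : Convex ℝ (normalSum q f x) :=
  convex_sum _ fun _ _ => convex_polarCone _

lemma smul_mem_normalSum {t : ℝ} (ht : 0 < t) {c : Eucl n} (hc : c ∈ normalSum q f x) :
    t • c ∈ normalSum q f x := by
  obtain ⟨v, hv, rfl⟩ := (Set.mem_finsetSum _ _ _).1 hc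
  refine (Set.mem_finsetSum _ _ _).2 ⟨fun i => t • v i, fun {i} hi d hd => ?_, by
    rw [Finset.smul_sum]⟩
  rw [real_inner_smul_left]
  exact mul_nonpos_of_nonneg_of_nonpos ht.le (hv hi d hd)

lemma inner_normalSum_nonpos {c d : Eucl n} (hc : c ∈ normalSum q f x)
    (hd : ∀ i, d ∈ descentCone (f i) x) : inner ℝ c d ≤ (0 : ℝ) := by
  obtain ⟨v, hv, rfl⟩ := (Set.mem_finsetSum _ _ _).1 hc
  rw [sum_inner]
  exact Finset.sum_nonpos fun i hi => hv hi d (hd i)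

variable {q f}

lemma coneAndCompacts_subdifferential (hq : q < k) (hf : ∀ i, IsProperConvex (f i))
    (hne : ∀ i, (subdifferential (f i) x).Nonempty)
    (hcpt : ∀ i : Fin (k + 1), i.val ≤ q → IsCompact (subdifferential (f i) x)) :
    ConeAndCompacts (closure (normalSum q f x))
      (fun i : Fin (q + 1) => subdifferential (f (i.castLE (by omega))) x) where
  isClosed := isClosed_closure
  convex_cone := (convex_normalSum q f x).closure
  zero_mem := subset_closure (zero_mem_normalSum q f x)
  smul_mem t ht c hc := map_mem_closure (f := fun c => t • c) (by fun_prop) hc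
    fun _ hv => smul_mem_normalSum q f x ht hv
  isCompact i := hcpt _ (by simpa using Nat.le_of_lt_succ i.2)
  convex i := convex_subdifferential (hf _)
  nonempty i := hne _

lemma distSq_eq (hq : q < k) (hne : ∀ i, (subdifferential (f i) x).Nonempty)
    (τ : Eucl (q + 1)) (g : Eucl n) :
    distSq hq f x τ g = Metric.infDist g (weightedSum (closure (normalSum q f x))
      (fun i : Fin (q + 1) => subdifferential (f (i.castLE (by omega))) x) τ) ^ 2 := by
  have hS : (subdiffSum hq f x τ).Nonempty := by
    choose s hs using hne
    exact ⟨_, mem_sum_smul.2 ⟨fun i => s _, fun i => hs _, rfl⟩⟩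
  rw [distSq, add_comm]
  congr 1
  exact (infDist_add_closure ⟨0, zero_mem_normalSum q f x⟩ hS g).symm

lemma supSq_priorRestrictedCone_le (hq : q < k) (hf : ∀ i, IsProperConvex (f i))
    (hne : ∀ i, (subdifferential (f i) x).Nonempty) {τ : Eucl (q + 1)}
    (hτ : τ ∈ nonnegOrthant (q + 1)) (g : Eucl n) :
    supSq (priorRestrictedCone f x) g ≤ distSq hq f x τ g := by
  set T := priorRestrictedCone f x ∩ Metric.closedBall (0 : Eucl n) 1 with hT
  have hTB : ∀ t ∈ T, ‖t‖ ≤ 1 := fun t ht => by simpa using ht.2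
  have h0 : (0 : Eucl n) ∈ T := ⟨⟨1, one_pos, fun i => by simp⟩, by simp⟩
  have hS : (subdiffSum hq f x τ + normalSum q f x).Nonempty := by
    choose s hs using hne
    exact ⟨_, Set.add_mem_add (mem_sum_smul.2 ⟨fun i => s _, fun i => hs _, rfl⟩)
      (zero_mem_normalSum q f x)⟩
  refine pow_le_pow_left₀ ((inner_zero_right g).symm.le.trans (inner_le_supportFn hTB g h0)) ?_ 2
  refine supportFn_le ⟨0, h0⟩ fun u hu => (Metric.le_infDist hS).2 ?_
  rintro _ ⟨c, hc, v, hv, rfl⟩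
  obtain ⟨s, hs, rfl⟩ := mem_sum_smul.1 hc
  have hdes : ∀ i, u ∈ descentCone (f i) x := by
    obtain ⟨t, ht, hdes⟩ := hu.1
    exact fun i => ⟨t, ht, hdes i⟩
  have h1 := inner_normalSum_nonpos q f x hv hdes
  have h2 : inner ℝ (∑ i, τ i • s i) u ≤ (0 : ℝ) := by
    rw [sum_inner]
    refine Finset.sum_nonpos fun i _ => ?_
    rw [real_inner_smul_left]
    exact mul_nonpos_of_nonneg_of_nonpos (hτ i) (inner_subgradient_nonpos (hf _) (hs i) (hdes _))
  set w := ∑ i, τ i • s i with hw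
  have h3 : inner ℝ (g - (w + v)) u ≤ ‖g - (w + v)‖ :=
    (real_inner_le_norm _ _).trans (mul_le_of_le_one_right (norm_nonneg _) (hTB u hu))
  rw [inner_sub_left, inner_add_left] at h3
  rw [dist_eq_norm]
  change inner ℝ g u ≤ ‖g - (w + v)‖
  linarith

lemma integrable_supSq {μ : Measure (Eucl n)} [IsFiniteMeasure μ] (hμ : MemLp id 2 μ)
    {C : Set (Eucl n)} (hC : (0 : Eucl n) ∈ C) : Integrable (supSq C) μ := by
  have hTB : ∀ t ∈ C ∩ Metric.closedBall (0 : Eucl n) 1, ‖t‖ ≤ 1 :=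
    fun t ht => by simpa using ht.2
  have hne : (C ∩ Metric.closedBall (0 : Eucl n) 1).Nonempty := ⟨0, hC, by simp⟩
  refine integrable_of_le_sq_norm hμ (a := 0) ((continuous_supportFn hne hTB).pow 2) fun g => ?_
  have h1 := abs_supportFn_le hne hTB g
  rw [one_mul] at h1
  rw [zero_add]
  change |supportFn _ g ^ 2| ≤ _
  rw [abs_pow]
  exact pow_le_pow_left₀ (abs_nonneg _) h1 2

theorem mainTheorem3 {n k q : ℕ} (hq : q < k)
    (f : Fin (k + 1) → Eucl n → EReal) (hf : ∀ i, IsProperConvex (f i)) (x : Eucl n)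
    (hne : ∀ i, (subdifferential (f i) x).Nonempty)
    (hcpt : ∀ i : Fin (k + 1), i.val ≤ q → IsCompact (subdifferential (f i) x))
    (hzero : ∀ i : Fin (k + 1), i.val ≤ q → (0 : Eucl n) ∉ subdifferential (f i) x)
    (hri : (⋂ i, intrinsicInterior ℝ (descentCone (f i) x)).Nonempty)
    (hsum : ∀ τ ∈ Metric.sphere (0 : Eucl (q + 1)) 1 ∩ nonnegOrthant (q + 1),
      (0 : Eucl n) ∉ closure (normalSum q f x) + subdiffSum hq f x τ) :
    -- the expectations are finite
    Integrable (supSq (priorRestrictedCone f x)) (stdGaussian (Eucl n)) ∧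
    (∀ τ ∈ nonnegOrthant (q + 1), Integrable (distSq hq f x τ) (stdGaussian (Eucl n))) ∧
    -- the upper bound
    statDim (priorRestrictedCone f x) ≤ ⨅ τ : nonnegOrthant (q + 1), recipeJ hq f x τ ∧
    -- convexity and continuity
    ConvexOn ℝ (nonnegOrthant (q + 1)) (recipeJ hq f x) ∧
    ContinuousOn (recipeJ hq f x) (nonnegOrthant (q + 1)) ∧
    -- continuous differentiability; partial derivatives are right derivatives where `τ i = 0`
    ContDiffOn ℝ 1 (recipeJ hq f x) (nonnegOrthant (q + 1)) ∧
    (∃ G : Eucl (q + 1) → Eucl (q + 1), ContinuousOn G (nonnegOrthant (q + 1)) ∧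
      ∀ τ ∈ nonnegOrthant (q + 1),
        HasGradientWithinAt (recipeJ hq f x) (G τ) (nonnegOrthant (q + 1)) τ ∧
        ∀ i, HasDerivWithinAt
          (fun s : ℝ => recipeJ hq f x (τ + s • EuclideanSpace.single i (1 : ℝ)))
          (G τ i) (Set.Ici (-(τ i))) 0) ∧
    -- the minimum is attained, and all minimizers lie in a compact subset
    (∃ C ⊆ nonnegOrthant (q + 1), IsCompact C ∧
      (∃ τ ∈ C, IsMinOn (recipeJ hq f x) (nonnegOrthant (q + 1)) τ) ∧
      ∀ τ ∈ nonnegOrthant (q + 1),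
        IsMinOn (recipeJ hq f x) (nonnegOrthant (q + 1)) τ → τ ∈ C) ∧
    -- strict convexity and uniqueness of the minimizer
    ((∀ τ ∈ nonnegOrthant (q + 1), ∀ τ' ∈ nonnegOrthant (q + 1), τ ≠ τ' →
        closure (normalSum q f x) + subdiffSum hq f x τ ≠
          closure (normalSum q f x) + subdiffSum hq f x τ') →
      StrictConvexOn ℝ (nonnegOrthant (q + 1)) (recipeJ hq f x) ∧
      ∃! τ, τ ∈ nonnegOrthant (q + 1) ∧
        IsMinOn (recipeJ hq f x) (nonnegOrthant (q + 1)) τ) := by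

  have hS := coneAndCompacts_subdifferential x hq hf hne hcpt
  set S := fun i : Fin (q + 1) => subdifferential (f (i.castLE (by omega))) x
  have hμ : MemLp id 2 (stdGaussian (Eucl n)) := IsGaussian.memLp_two_id
  have := isOpenPosMeasure_stdGaussian (E := Eucl n)
  have hdist : ∀ τ, distSq hq f x τ = fun g => Metric.infDist g (weightedSum
      (closure (normalSum q f x)) S τ) ^ 2 := fun τ => funext (distSq_eq x hq hne τ)
  have hJ : recipeJ hq f x = meanDistSq (stdGaussian (Eucl n)) (closure (normalSum q f x)) S := by
    funext τ
    rw [recipeJ, hdist, meanDistSq]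
  have hdistint : ∀ τ, Integrable (distSq hq f x τ) (stdGaussian (Eucl n)) := fun τ => by
    rw [hdist]
    exact integrable_infDist_sq hμ _
  have hsup : Integrable (supSq (priorRestrictedCone f x)) (stdGaussian (Eucl n)) :=
    integrable_supSq hμ ⟨1, one_pos, fun i => by simp⟩
  have hbound : statDim (priorRestrictedCone f x) ≤
      ⨅ τ : nonnegOrthant (q + 1), recipeJ hq f x τ := by
    have : Nonempty (nonnegOrthant (q + 1)) := ⟨⟨0, fun _ => le_rfl⟩⟩
    exact le_ciInf fun τ => integral_mono hsup (hdistint τ)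
      (supSq_priorRestrictedCone_le x hq hf hne τ.2)
  have hG := hS.continuousOn_meanGrad hμ
  have hsub : ∀ τ ∈ orthant (Fin (q + 1)), ∀ τ' ∈ orthant (Fin (q + 1)), _ :=
    fun τ hτ τ' hτ' => hS.meanDistSq_subgradient hμ hτ hτ'
  have hgrad : ∀ τ ∈ orthant (Fin (q + 1)), _ :=
    fun τ hτ => hasGradientWithinAt_of_subgradient hG hsub hτ
  have hcont : ContinuousOn (meanDistSq (stdGaussian (Eucl n)) (closure (normalSum q f x)) S)
      (orthant (Fin (q + 1))) := fun τ hτ => (hgrad τ hτ).continuousWithinAt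
  have hmin := hS.exists_isCompact_minimizers hμ hcont fun τ hτ => hsum τ hτ
  rw [hJ] at hbound ⊢
  refine ⟨hsup, fun τ _ => hdistint τ, hbound,
    convexOn_of_subgradient (convex_orthant _) hsub, hcont,
    contDiffOn_one_of_hasGradientWithinAt hG hgrad,
    ⟨_, hG, fun τ hτ => ⟨hgrad τ hτ, (hgrad τ hτ).hasDerivWithinAt_single hτ⟩⟩, hmin,
    fun hinj => ?_⟩
  have hstrict := hS.strictConvexOn_meanDistSq hμ hinj
  obtain ⟨C, hC, -, ⟨τ, hτ, hτmin⟩, -⟩ := hmin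
  exact ⟨hstrict, τ, ⟨hC hτ, hτmin⟩, fun τ' hτ' =>
    hstrict.eq_of_isMinOn hτ'.2 hτmin hτ'.1 (hC hτ)⟩
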